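/- Let $\Sigma$ be a finite directed graph (also write $\Sigma$ for its vertex set), and let $B\subseteq\Sigma$ be a set of vertices such that no two distinct vertices of $B$ are joined by arrows in both directions. Let $(e_k)_{k\in\Sigma}$ be the standard basis of $\mathbb{Z}^\Sigma$, let $\xi_k$ be the coordinate functions, and let $\Omega=\sum_{(k\to l)\in\Sigma}\xi_k\wedge\xi_l$, i.e. $\Omega(v,w)=\sum_{(k\to l)\in\Sigma}(\xi_k(v)\xi_l(w)-\xi_l(v)\xi_k(w))$. Let $\Gamma_{\Sigma,B}\subset GL(\mathbb{Z}^\Sigma)$ be the group generated by the transvections $\tau_k(v)=v-\Omega(v,e_k)e_k$ for $k\in B$, let $\Gamma_{\Sigma,B}(\mathbb{F}_2)\subset GL(\mathbb{F}_2^\Sigma)$ be the group obtained from it by reduction modulo $2$, and let $\overline\Omega$ be the $\mathbb{F}_2$-valued bilinear form on $\mathbb{F}_2^\Sigma$ obtained from $\Omega$ by reduction modulo $2$, with kernel $\mathrm{Ker}\,\overline\Omega=\{v:\overline\Omega(v,w)=0\text{ for all }w\in\mathbb{F}_2^\Sigma\}$. Call a finite undirected graph $E_6$-compatible if it is connected and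 contains an induced subgraph with $6$ vertices isomorphic to the Dynkin graph $E_6$. Suppose that the induced subgraph with vertex set $B$ of the undirected graph underlying $\Sigma$ is $E_6$-compatible. Then the number of $\Gamma_{\Sigma,B}(\mathbb{F}_2)$-orbits in $\mathbb{F}_2^\Sigma$ is equal to $$2^{\#(\Sigma\setminus B)}\cdot\left(2+2^{\dim(\mathbb{F}_2^B\cap\mathrm{Ker}\,\overline\Omega)}\right),$$ where $\mathbb{F}_2^B\subseteq\mathbb{F}_2^\Sigma$ is the span of the $e_b$, $b\in B$. -/

import Mathlib

noncomputable section

namespace SymplecticTransvections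

/-- The Dynkin graph `E₆`: a chain `0 - 1 - 2 - 3 - 4` with the vertex `5` attached to `2`. -/
def dynkinE6 : SimpleGraph (Fin 6) :=
  SimpleGraph.fromEdgeSet {s(0, 1), s(1, 2), s(2, 3), s(3, 4), s(2, 5)}

/-- A graph is `E₆`-compatible if it is connected and contains an induced subgraph isomorphic to
the Dynkin graph `E₆`. -/
def E6Compatible {W : Type*} (G : SimpleGraph W) : Prop :=
  G.Connected ∧ dynkinE6.IsIndContained G

variable {V : Type*} [Fintype V]

open Classical in
/-- The skew-symmetric form `Ω = ∑_{k → l} ξ_k ∧ ξ_l` on the lattice `ℤ^V`. -/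
def omega (S : Digraph V) : LinearMap.BilinForm ℤ (V → ℤ) :=
  LinearMap.mk₂ ℤ
    (fun v w => ∑ k, ∑ l, if S.Adj k l then v k * w l - v l * w k else 0)
    (fun v v' w => by
      simp only [← Finset.sum_add_distrib]
      refine Finset.sum_congr rfl fun k _ => Finset.sum_congr rfl fun l _ => ?_
      split_ifs
      · simp only [Pi.add_apply]; ring
      · simp)
    (fun c v w => by
      simp only [smul_eq_mul, Finset.mul_sum]
      refine Finset.sum_congr rfl fun k _ => Finset.sum_congr rfl fun l _ => ?_
      split_ifs
      · simp only [Pi.smul_apply, smul_eq_mul]; ring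
      · simp)
    (fun v w w' => by
      simp only [← Finset.sum_add_distrib]
      refine Finset.sum_congr rfl fun k _ => Finset.sum_congr rfl fun l _ => ?_
      split_ifs
      · simp only [Pi.add_apply]; ring
      · simp)
    (fun c v w => by
      simp only [smul_eq_mul, Finset.mul_sum]
      refine Finset.sum_congr rfl fun k _ => Finset.sum_congr rfl fun l _ => ?_
      split_ifs
      · simp only [Pi.smul_apply, smul_eq_mul]; ring
      · simp)

theorem omega_self (S : Digraph V) (v : V → ℤ) : omega S v v = 0 := by
  simp only [omega, LinearMap.mk₂_apply]
  refine Finset.sum_eq_zero fun k _ => Finset.sum_eq_zero fun l _ => ?_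
  split_ifs
  · ring
  · rfl

variable [DecidableEq V]

/-- The symplectic transvection `τ_k(v) = v - Ω(v, e_k) e_k`, as an element of `GL(ℤ^V)`;
its inverse is `v ↦ v + Ω(v, e_k) e_k`. -/
def transvection (S : Digraph V) (k : V) : LinearMap.GeneralLinearGroup ℤ (V → ℤ) where
  val := LinearMap.id - (LinearMap.flip (omega S) (Pi.single k 1)).smulRight (Pi.single k 1)
  inv := LinearMap.id + (LinearMap.flip (omega S) (Pi.single k 1)).smulRight (Pi.single k 1)
  val_inv := by
    refine LinearMap.ext fun v => ?_
    simp only [Module.End.mul_apply, Module.End.one_apply, LinearMap.add_apply,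
      LinearMap.sub_apply, LinearMap.id_apply, LinearMap.smulRight_apply, LinearMap.flip_apply,
      map_add, map_smul, omega_self, zero_smul, sub_zero, sub_add_cancel]
  inv_val := by
    refine LinearMap.ext fun v => ?_
    simp only [Module.End.mul_apply, Module.End.one_apply, LinearMap.add_apply,
      LinearMap.sub_apply, LinearMap.id_apply, LinearMap.smulRight_apply, LinearMap.flip_apply,
      map_sub, map_smul, omega_self, zero_smul, add_zero, add_sub_cancel_right]

/-- The group `Γ_{S,B} ⊆ GL(ℤ^V)` generated by the transvections `τ_k`, `k ∈ B`. -/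
def transvectionGroup (S : Digraph V) (B : Set V) :
    Subgroup (LinearMap.GeneralLinearGroup ℤ (V → ℤ)) :=
  Subgroup.closure (transvection S '' B)

variable (V) in
/-- Reduction modulo `2`, `GL(ℤ^V) → GL(𝔽₂^V)`, taken entrywise on the matrix of a linear map in
the standard basis. -/
def reductionModTwo :
    LinearMap.GeneralLinearGroup ℤ (V → ℤ) →*
      LinearMap.GeneralLinearGroup (ZMod 2) (V → ZMod 2) :=
  (Matrix.GeneralLinearGroup.toLin (n := V) (R := ZMod 2)).toMonoidHom.comp
    ((Matrix.GeneralLinearGroup.map (Int.castRingHom (ZMod 2))).comp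
      (Matrix.GeneralLinearGroup.toLin (n := V) (R := ℤ)).symm.toMonoidHom)

/-- The group `Γ_{S,B}(𝔽₂)` obtained from `Γ_{S,B}` by reduction modulo `2`. -/
def transvectionGroupModTwo (S : Digraph V) (B : Set V) :
    Subgroup (LinearMap.GeneralLinearGroup (ZMod 2) (V → ZMod 2)) :=
  (transvectionGroup S B).map (reductionModTwo V)

/-- The `𝔽₂`-valued bilinear form on `𝔽₂^V` obtained from `Ω` by reduction modulo `2` (of its Gram
matrix in the standard basis). -/
def omegaModTwo (S : Digraph V) : LinearMap.BilinForm (ZMod 2) (V → ZMod 2) :=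
  Matrix.toBilin' ((LinearMap.BilinForm.toMatrix' (omega S)).map (Int.cast : ℤ → ZMod 2))

/-- The coordinate subspace `𝔽₂^B` of `𝔽₂^V`, spanned by the `e_b`, `b ∈ B`. -/
def coordSubspace (B : Set V) : Submodule (ZMod 2) (V → ZMod 2) :=
  Submodule.span (ZMod 2) ((fun b : V => (Pi.single b 1 : V → ZMod 2)) '' B)

end SymplecticTransvections

end

open SymplecticTransvections

/-! Let Q be the quadratic form on 𝔽₂^V with polar form Ω mod 2 and value 1 on every basis vector.
Transvections in B preserve Q and each coset of 𝔽₂^B, and they fix exactly the vectors orthogonal to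
𝔽₂^B. The claim is that within a coset the non-fixed vectors with a given Q form a single nonempty
orbit. The orbits are then the fixed points, counted by `card_orthogonal`, together with two orbits
for each of the 2^#(Σ∖B) cosets.

Transitivity is proved by growing the E₆ subgraph. The E₆ form mod 2 is nondegenerate, so vectors
split off an E₆ component and the base case `quadSeparatesOrbits` is a check on 64 vectors.
Connectedness lets vertices be adjoined one at a time, each adjacent to an earlier one;
`quadSeparatesOrbits_insert` shows that transitivity survives, with `exists_connecting` providing
the crossing between old cosets. -/

namespace SymplecticTransvections

/-! ### Finite computations in the E₆ lattice mod 2 -/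

/-- The Gram matrix modulo `2` of the graph `E₆`. -/
def gramE6 (i j : Fin 6) : ZMod 2 :=
  !![0, 1, 0, 0, 0, 0; 1, 0, 1, 0, 0, 0; 0, 1, 0, 1, 0, 1;
     0, 0, 1, 0, 1, 0; 0, 0, 0, 1, 0, 0; 0, 0, 1, 0, 0, 0] i j

/-- The pairing of `f` with the `i`-th basis vector of the `E₆` lattice modulo `2`. -/
def pairE6 (f : Fin 6 → ZMod 2) (i : Fin 6) : ZMod 2 := ∑ j, f j * gramE6 j i

/-- The quadratic form of the `E₆` lattice modulo `2`. -/
def quadE6 (f : Fin 6 → ZMod 2) : ZMod 2 :=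
  ∑ i, f i + (f 0 * f 1 + f 1 * f 2 + f 2 * f 3 + f 3 * f 4 + f 2 * f 5)

/-- The graph distance in the transvection orbit of `f` to a chosen base point, read off from the
hexadecimal digits of a numeral. -/
def rankE6 (f : Fin 6 → ZMod 2) : ℕ :=
  (0x152122754452336124323382354786512432134435432452334102534454550 /
    16 ^ (∑ i, (f i).val * 2 ^ (i : ℕ))) % 16

theorem dynkinE6_gram (i j : Fin 6) [Decidable (dynkinE6.Adj i j)] :
    gramE6 i j = if dynkinE6.Adj i j then 1 else 0 := by
  have h : ∀ i j, dynkinE6.Adj i j ↔ gramE6 i j = 1 := by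
    simp only [dynkinE6, SimpleGraph.fromEdgeSet_adj, Set.mem_insert_iff, Set.mem_singleton_iff]
    decide +kernel
  have h2 : ∀ a : ZMod 2, a = if a = 1 then 1 else 0 := by decide
  simp only [h]
  exact h2 _

/-- Nondegeneracy: the E₆ Cartan determinant is 3, which is odd. -/
theorem exists_pairE6_eq (a : Fin 6 → ZMod 2) : ∃ f, ∀ i, pairE6 f i = a i := by
  revert a
  decide +kernel

/-- Avoiding both 0 and `e` keeps `f` and `f + e` nonzero, so neither end of a later crossing move
is fixed. -/
theorem exists_pairE6_quadE6 (e : Fin 6 → ZMod 2) (he : e ≠ 0) (a d : ZMod 2) :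
    ∃ f : Fin 6 → ZMod 2, f ≠ 0 ∧ f ≠ e ∧ ∑ i, f i * pairE6 e i = a ∧ quadE6 f = d := by
  revert e
  revert a d
  decide +kernel

theorem exists_quadE6_eq (d : ZMod 2) : ∃ f : Fin 6 → ZMod 2, f ≠ 0 ∧ quadE6 f = d := by
  revert d
  decide +kernel

/-- The point of rank zero in the orbit of vectors with quadratic form `q`. -/
def baseE6 (q : ZMod 2) : Fin 6 → ZMod 2 := ![q, 1, q, 1, q, q]

/-- A descent certificate: tabulated distances reduce connectivity of the orbits to one local check
per vector. -/
theorem exists_rankE6_lt (f : Fin 6 → ZMod 2) (hf : f ≠ 0) (hb : f ≠ baseE6 (quadE6 f)) :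
    ∃ i, rankE6 (Function.update f i (f i + pairE6 f i)) < rankE6 f ∧
      Function.update f i (f i + pairE6 f i) ≠ 0 ∧
      quadE6 (Function.update f i (f i + pairE6 f i)) = quadE6 f := by
  revert f
  decide +kernel

/-! ### Transvection orbits over 𝔽₂ for an abstract quadratic form -/

section Abstract

variable {M : Type*} [AddCommGroup M] [Module (ZMod 2) M]

/-- `Q` is a quadratic form over `𝔽₂` with polar form `ω`. -/
def IsQuadraticRefinement (ω : LinearMap.BilinForm (ZMod 2) M) (Q : M → ZMod 2) : Prop :=
  ∀ x y, Q (x + y) = Q x + Q y + ω x y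

/-- `y` is obtained from `x` by the transvection in some `b ∈ B`. -/
def TransvectionStep (ω : LinearMap.BilinForm (ZMod 2) M) (B : Set M) (x y : M) : Prop :=
  ∃ b ∈ B, y = x + ω x b • b

/-- `y` is obtained from `x` by a sequence of transvections in elements of `B`. -/
def TransvectionReach (ω : LinearMap.BilinForm (ZMod 2) M) (B : Set M) : M → M → Prop :=
  Relation.ReflTransGen (TransvectionStep ω B)

/-- `x` is fixed by all transvections in elements of `B`. -/
def IsTransvectionFixed (ω : LinearMap.BilinForm (ZMod 2) M) (B : Set M) (x : M) : Prop :=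
  ∀ b ∈ B, ω x b = 0

/-- In each coset of the span of `B`, the quadratic form `Q` separates the nontrivial orbits of
the group generated by the transvections in elements of `B`. -/
def QuadSeparatesOrbits (ω : LinearMap.BilinForm (ZMod 2) M) (Q : M → ZMod 2) (B : Set M) : Prop :=
  ∀ x y, x + y ∈ Submodule.span (ZMod 2) B → ¬ IsTransvectionFixed ω B x →
    ¬ IsTransvectionFixed ω B y → Q x = Q y → TransvectionReach ω B x y

/-- The vectors `e i` form an `E₆` configuration for `ω` and `Q`. -/
structure IsE6Config (ω : LinearMap.BilinForm (ZMod 2) M) (Q : M → ZMod 2) (e : Fin 6 → M) :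
    Prop where
  gram : ∀ i j, ω (e i) (e j) = gramE6 i j
  quad : ∀ i, Q (e i) = 1

theorem zmodTwo_eq_zero_or_one (a : ZMod 2) : a = 0 ∨ a = 1 := by
  revert a; decide

variable {ω : LinearMap.BilinForm (ZMod 2) M} {Q : M → ZMod 2} {B : Set M}

theorem add_add_self_cancel (x y : M) : x + y + y = x := by
  rw [add_assoc, ZModModule.add_self, add_zero]

namespace IsQuadraticRefinement

variable (hQ : IsQuadraticRefinement ω Q)
include hQ

theorem map_zero : Q 0 = 0 := by
  have h := hQ 0 0
  simpa using h

theorem form_self (x : M) : ω x x = 0 := by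
  have h := hQ x x
  rw [ZModModule.add_self, hQ.map_zero, CharTwo.add_self_eq_zero, zero_add] at h
  exact h.symm

theorem form_comm (x y : M) : ω x y = ω y x := by
  have h1 := hQ x y
  have h2 := hQ y x
  rw [add_comm y x, h1, add_comm (Q y)] at h2
  exact add_left_cancel h2

theorem map_smul (a : ZMod 2) (x : M) : Q (a • x) = a * Q x := by
  obtain rfl | rfl := zmodTwo_eq_zero_or_one a
  · simp [hQ.map_zero]
  · simp

theorem step_symm {x y : M} (h : TransvectionStep ω B x y) : TransvectionStep ω B y x := by
  obtain ⟨b, hb, rfl⟩ := h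
  refine ⟨b, hb, ?_⟩
  rw [map_add, LinearMap.add_apply, _root_.map_smul, LinearMap.smul_apply, hQ.form_self, smul_zero,
    add_zero, add_add_self_cancel]

theorem reach_symm {x y : M} (h : TransvectionReach ω B x y) : TransvectionReach ω B y x := by
  induction h with
  | refl => exact .refl
  | tail _ h ih => exact .head (hQ.step_symm h) ih

/-- With a = ω(x, b), a step changes Q by a·Q(b) + a² = a + a² = 0. -/
theorem reach_quad (hB : ∀ b ∈ B, Q b = 1) {x y : M} (h : TransvectionReach ω B x y) :
    Q y = Q x := by
  induction h with
  | refl => rfl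
  | tail _ h ih =>
    obtain ⟨b, hb, rfl⟩ := h
    rw [hQ, hQ.map_smul, hB b hb, _root_.map_smul, smul_eq_mul, ih]
    generalize ω _ _ = a
    revert a
    generalize Q x = c
    revert c
    decide

end IsQuadraticRefinement

theorem TransvectionReach.mono {B' : Set M} (h : B ⊆ B') {x y : M}
    (hr : TransvectionReach ω B x y) : TransvectionReach ω B' x y := by
  refine Relation.ReflTransGen.mono ?_ _ _ hr
  rintro _ _ ⟨b, hb, rfl⟩
  exact ⟨b, h hb, rfl⟩

theorem TransvectionReach.add_mem_span {x y : M} (h : TransvectionReach ω B x y) :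
    x + y ∈ Submodule.span (ZMod 2) B := by
  induction h with
  | refl => rw [ZModModule.add_self]; exact zero_mem _
  | tail _ h ih =>
    obtain ⟨b, hb, rfl⟩ := h
    rw [← add_assoc]
    exact add_mem ih (Submodule.smul_mem _ _ (Submodule.subset_span hb))

theorem TransvectionReach.single {b x : M} (hb : b ∈ B) (h : ω x b = 1) :
    TransvectionReach ω B x (x + b) :=
  Relation.ReflTransGen.single (show TransvectionStep ω B x (x + b) from
    ⟨b, hb, by rw [h, one_smul]⟩)

theorem TransvectionReach.eq_of_fixed {x y : M} (h : TransvectionReach ω B x y)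
    (hx : IsTransvectionFixed ω B x) : y = x := by
  induction h with
  | refl => rfl
  | tail _ h ih =>
    obtain ⟨b, hb, rfl⟩ := h
    subst ih
    rw [hx b hb, zero_smul, add_zero]

/-- The linear combination of an `E₆` configuration with coefficients `f`. -/
def combE6 (e : Fin 6 → M) (f : Fin 6 → ZMod 2) : M := ∑ i, f i • e i

theorem combE6_mem_span {e : Fin 6 → M} (he : ∀ i, e i ∈ B) (f : Fin 6 → ZMod 2) :
    combE6 e f ∈ Submodule.span (ZMod 2) B :=
  sum_mem fun i _ => Submodule.smul_mem _ _ (Submodule.subset_span (he i))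

theorem combE6_update (e : Fin 6 → M) (f : Fin 6 → ZMod 2) (i : Fin 6) (a : ZMod 2) :
    combE6 e (Function.update f i (f i + a)) = combE6 e f + a • e i := by
  have : Function.update f i (f i + a) = f + Pi.single i a := by
    ext j
    by_cases h : j = i
    · subst h; simp
    · simp [h]
  rw [this, combE6, combE6]
  simp [add_smul, Finset.sum_add_distrib, Pi.single_apply]

theorem form_combE6_of_orthogonal {e : Fin 6 → M} {z : M} (hz : ∀ i, ω z (e i) = 0) (f : Fin 6 → ZMod 2) :
    ω z (combE6 e f) = 0 := by
  simp [combE6, hz]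

theorem exists_pairE6_ne_zero {f : Fin 6 → ZMod 2} (hf : f ≠ 0) : ∃ i, pairE6 f i ≠ 0 := by
  by_contra! h
  obtain ⟨g, -, -, hg, -⟩ := exists_pairE6_quadE6 f hf 1 0
  simp [h] at hg

/-! ### Splitting off an E₆ component and adjoining a vector -/

namespace IsE6Config

variable {e : Fin 6 → M} (he : IsE6Config ω Q e)
include he

theorem form_comb (f : Fin 6 → ZMod 2) (i : Fin 6) : ω (combE6 e f) (e i) = pairE6 f i := by
  simp [combE6, pairE6, he.gram]

theorem form_comb_comb (f g : Fin 6 → ZMod 2) :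
    ω (combE6 e f) (combE6 e g) = ∑ i, g i * pairE6 f i := by
  conv_lhs => rw [combE6.eq_1 e g]
  simp [he.form_comb]

theorem quad_comb (hQ : IsQuadraticRefinement ω Q) (f : Fin 6 → ZMod 2) :
    Q (combE6 e f) = quadE6 f := by
  simp only [combE6, quadE6, Fin.sum_univ_six, hQ _ _, hQ.map_smul, he.quad, map_add,
    LinearMap.add_apply, map_smul, LinearMap.smul_apply, he.gram, smul_eq_mul]
  simp [gramE6]
  ring

theorem exists_orthogonal (x : M) : ∃ f, ∀ i, ω (x + combE6 e f) (e i) = 0 := by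
  obtain ⟨f, hf⟩ := exists_pairE6_eq fun i => ω x (e i)
  exact ⟨f, fun i => by
    rw [map_add, LinearMap.add_apply, he.form_comb, hf, CharTwo.add_self_eq_zero]⟩

theorem not_fixed_add_comb (heB : ∀ i, e i ∈ B) {z : M} (hz : ∀ i, ω z (e i) = 0)
    {f : Fin 6 → ZMod 2} (hf : f ≠ 0) : ¬ IsTransvectionFixed ω B (z + combE6 e f) := by
  intro h
  obtain ⟨i, hi⟩ := exists_pairE6_ne_zero hf
  apply hi
  have := h (e i) (heB i)
  rwa [map_add, LinearMap.add_apply, hz, zero_add, he.form_comb] at this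

theorem quad_add_comb (hQ : IsQuadraticRefinement ω Q) {z : M} (hz : ∀ i, ω z (e i) = 0)
    (f : Fin 6 → ZMod 2) : Q (z + combE6 e f) = Q z + quadE6 f := by
  rw [hQ, form_combE6_of_orthogonal hz, he.quad_comb hQ, add_zero]

/-- Every coset of the span contains nontrivial orbits with both values of `Q`. -/
theorem exists_not_fixed (hQ : IsQuadraticRefinement ω Q) (heB : ∀ i, e i ∈ B) (x : M)
    (q : ZMod 2) : ∃ y, x + y ∈ Submodule.span (ZMod 2) B ∧ ¬ IsTransvectionFixed ω B y ∧
      Q y = q := by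
  obtain ⟨f, hf⟩ := he.exists_orthogonal x
  obtain ⟨g, hg, hgq⟩ := exists_quadE6_eq (q + Q (x + combE6 e f))
  refine ⟨x + combE6 e f + combE6 e g, ?_, he.not_fixed_add_comb heB hf hg, ?_⟩
  · rw [← add_assoc, ← add_assoc, ZModModule.add_self, zero_add]
    exact add_mem (combE6_mem_span heB _) (combE6_mem_span heB _)
  · rw [he.quad_add_comb hQ hf, hgq, add_comm q, ← add_assoc, CharTwo.add_self_eq_zero, zero_add]

/-- The part `z` orthogonal to E₆ is inert, so the descent takes place among the 64 coefficient
vectors. -/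
theorem reach_base {z : M} (hz : ∀ i, ω z (e i) = 0)
    {f : Fin 6 → ZMod 2} (hf : f ≠ 0) :
    TransvectionReach ω (Set.range e) (z + combE6 e f) (z + combE6 e (baseE6 (quadE6 f))) := by
  induction hn : rankE6 f using Nat.strong_induction_on generalizing f with
  | _ n ih =>
    by_cases hb : f = baseE6 (quadE6 f)
    · rw [← hb]; exact .refl
    obtain ⟨i, h1, h2, h3⟩ := exists_rankE6_lt f hf hb
    rw [← h3]
    refine .head ⟨e i, ⟨i, rfl⟩, ?_⟩ (ih _ (hn ▸ h1) h2 rfl)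
    rw [combE6_update, map_add, LinearMap.add_apply, hz, zero_add, he.form_comb, add_assoc]

theorem quadSeparatesOrbits (hQ : IsQuadraticRefinement ω Q) :
    QuadSeparatesOrbits ω Q (Set.range e) := by
  intro x y hxy hx hy hq
  obtain ⟨f, hf⟩ := he.exists_orthogonal x
  obtain ⟨c, hc⟩ := (Submodule.mem_span_range_iff_exists_fun _).1 hxy
  set z := x + combE6 e f with hz
  have hxz : x = z + combE6 e f := by rw [hz, add_add_self_cancel]
  have hyz : y = z + combE6 e (f + c) := by
    have h : combE6 e (f + c) = combE6 e f + (x + y) := by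
      rw [← hc]; simp [combE6, add_smul, Finset.sum_add_distrib]
    rw [h, ← add_assoc, ← hxz, ← add_assoc, ZModModule.add_self, zero_add]
  have key : ∀ {w : M} {g : Fin 6 → ZMod 2}, ¬ IsTransvectionFixed ω (Set.range e) w →
      w = z + combE6 e g → g ≠ 0 := by
    rintro w g hw rfl rfl
    refine hw ?_
    rintro _ ⟨i, rfl⟩
    simpa [combE6] using hf i
  have hfx := key hx hxz
  have hfy := key hy hyz
  rw [hxz, hyz, he.quad_add_comb hQ hf, he.quad_add_comb hQ hf] at hq
  have h1 := he.reach_base hf hfx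
  have h2 := he.reach_base hf hfy
  rw [← add_left_cancel hq, ← hyz] at h2
  rw [← hxz] at h1
  exact h1.trans (hQ.reach_symm h2)

/-- Each coset contains a vector, with prescribed value of `Q`, moved by the transvection in `c`
and which is not fixed by `B` before or after this move. -/
theorem exists_connecting (hQ : IsQuadraticRefinement ω Q) (heB : ∀ i, e i ∈ B) {b c : M}
    (hb : b ∈ B) (hbc : ω b c = 1) (x : M) (q : ZMod 2) :
    ∃ y, x + y ∈ Submodule.span (ZMod 2) B ∧ Q y = q ∧ ω y c = 1 ∧
      ¬ IsTransvectionFixed ω B y ∧ ¬ IsTransvectionFixed ω B (y + c) := by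
  obtain ⟨f, hf⟩ := he.exists_orthogonal x
  obtain ⟨g, hg⟩ := he.exists_orthogonal c
  have hcg : c = c + combE6 e g + combE6 e g := (add_add_self_cancel _ _).symm
  set c' := c + combE6 e g with hc'
  -- Here `g` is the E₆ component of `c`. If it vanishes, E₆ vectors cannot alter the pairing with
  -- `c`, and `b` must be used instead.
  by_cases hg0 : g = 0
  · have hcc : ∀ i, ω c (e i) = 0 := by
      intro i
      simpa [hc', hg0, combE6] using hg i
    obtain ⟨s, hs⟩ := he.exists_orthogonal b
    set w := b + combE6 e s with hw
    have hwc : ω w c = 1 := by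
      rw [hw, map_add, LinearMap.add_apply, hbc, hQ.form_comm, form_combE6_of_orthogonal hcc,
        add_zero]
    have hwB : w ∈ Submodule.span (ZMod 2) B :=
      add_mem (Submodule.subset_span hb) (combE6_mem_span heB _)
    -- Since `w` is orthogonal to E₆ and pairs to 1 with `c`, this coefficient forces ω(z, c) = 1.
    set a := ω (x + combE6 e f) c + 1 with ha
    set z := x + combE6 e f + a • w with hz
    have hzo : ∀ i, ω z (e i) = 0 := by
      intro i
      rw [hz, map_add, LinearMap.add_apply, hf, map_smul, LinearMap.smul_apply, hs, smul_zero,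
        add_zero]
    obtain ⟨h, hh, hhq⟩ := exists_quadE6_eq (q + Q z)
    refine ⟨z + combE6 e h, ?_, ?_, ?_, he.not_fixed_add_comb heB hzo hh, ?_⟩
    · rw [hz, ← add_assoc, ← add_assoc, ← add_assoc, ZModModule.add_self, zero_add]
      exact add_mem (add_mem (combE6_mem_span heB _) (Submodule.smul_mem _ _ hwB))
        (combE6_mem_span heB _)
    · rw [he.quad_add_comb hQ hzo, hhq, add_comm q, ← add_assoc, CharTwo.add_self_eq_zero,
        zero_add]
    · rw [map_add, LinearMap.add_apply, hQ.form_comm (combE6 e h),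
        form_combE6_of_orthogonal hcc, add_zero, hz, map_add, LinearMap.add_apply, map_smul,
        LinearMap.smul_apply, hwc, smul_eq_mul, mul_one, ha, ← add_assoc,
        CharTwo.add_self_eq_zero, zero_add]
    · rw [add_right_comm]
      refine he.not_fixed_add_comb heB (fun i => ?_) hh
      rw [map_add, LinearMap.add_apply, hzo, hcc, add_zero]
  · set z := x + combE6 e f with hz
    -- The targets make the total pairing with `c` equal to 1 and Q equal to `q`; `h ≠ g` keeps the
    -- E₆ component `h + g` nonzero after adding `c`.
    obtain ⟨h, hh, hhg, hha, hhq⟩ := exists_pairE6_quadE6 g hg0 (ω z c + 1) (q + Q z)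
    refine ⟨z + combE6 e h, ?_, ?_, ?_, he.not_fixed_add_comb heB hf hh, ?_⟩
    · rw [hz, ← add_assoc, ← add_assoc, ZModModule.add_self, zero_add]
      exact add_mem (combE6_mem_span heB _) (combE6_mem_span heB _)
    · rw [he.quad_add_comb hQ hf, hhq, add_comm q, ← add_assoc, CharTwo.add_self_eq_zero,
        zero_add]
    · have h1 : ω (combE6 e h) c = ω z c + 1 := by
        rw [hQ.form_comm, hcg, map_add, LinearMap.add_apply, form_combE6_of_orthogonal hg,
          zero_add, he.form_comb_comb, hha]
        rw [← hcg]
      rw [map_add, LinearMap.add_apply, h1, ← add_assoc, CharTwo.add_self_eq_zero, zero_add]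
    · have h2 : z + combE6 e h + c = (z + c') + combE6 e (h + g) := by
        have : combE6 e (h + g) = combE6 e h + combE6 e g := by
          simp [combE6, add_smul, Finset.sum_add_distrib]
        rw [this]
        nth_rewrite 1 [hcg]
        abel
      rw [h2]
      refine he.not_fixed_add_comb heB (fun i => ?_) fun h0 => hhg ?_
      · rw [map_add, LinearMap.add_apply, hf, hg, add_zero]
      · rw [← add_add_self_cancel h g, h0, zero_add]

/-- A new coset is a union of at most two old ones, exchanged by adding `c`. Vectors fixed by B but
moved by `c` become non-fixed after that move, because ω(b, c) = 1. -/
theorem quadSeparatesOrbits_insert (hQ : IsQuadraticRefinement ω Q) (hB : ∀ b ∈ B, Q b = 1)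
    (heB : ∀ i, e i ∈ B) (hs : QuadSeparatesOrbits ω Q B) {b c : M} (hb : b ∈ B)
    (hbc : ω b c = 1) (hc : Q c = 1) : QuadSeparatesOrbits ω Q (insert c B) := by
  have hsub : B ⊆ insert c B := Set.subset_insert _ _
  have hcm : c ∈ insert c B := Set.mem_insert _ _
  have hB' : ∀ b ∈ insert c B, Q b = 1 := by
    rintro b (rfl | hb)
    exacts [hc, hB b hb]
  have move : ∀ x, ¬ IsTransvectionFixed ω (insert c B) x →
      ∃ x', TransvectionReach ω (insert c B) x x' ∧ ¬ IsTransvectionFixed ω B x' := by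
    intro x hx
    by_cases hxB : IsTransvectionFixed ω B x
    · have hxc : ω x c = 1 := by
        refine (zmodTwo_eq_zero_or_one _).resolve_left fun h => hx ?_
        rintro b (rfl | hb)
        exacts [h, hxB b hb]
      refine ⟨x + c, .single hcm hxc, fun h => ?_⟩
      have := h b hb
      rw [map_add, LinearMap.add_apply, hxB b hb, hQ.form_comm, hbc, zero_add] at this
      exact one_ne_zero this
    · exact ⟨x, .refl, hxB⟩
  have main : ∀ x y, x + y ∈ Submodule.span (ZMod 2) (insert c B) →
      ¬ IsTransvectionFixed ω B x → ¬ IsTransvectionFixed ω B y → Q x = Q y →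
      TransvectionReach ω (insert c B) x y := by
    intro x y hxy hx hy hq
    obtain ⟨a, z, hz, hxyz⟩ := Submodule.mem_span_insert.1 hxy
    obtain rfl | rfl := zmodTwo_eq_zero_or_one a
    · rw [zero_smul, zero_add] at hxyz
      exact (hs x y (hxyz ▸ hz) hx hy hq).mono hsub
    · rw [one_smul] at hxyz
      obtain ⟨w, hw, hwq, hwc, hwf, hwcf⟩ := he.exists_connecting hQ heB hb hbc x (Q x)
      -- The route is x → w → w + c → y, with only the middle move leaving the old coset.
      refine ((hs x w hw hx hwf hwq.symm).mono hsub).trans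
        ((TransvectionReach.single hcm hwc).trans ((hs (w + c) y ?_ hwcf hy ?_).mono hsub))
      · have : w + c + y = (x + w) + z := by
          have h : z = x + y + c := by rw [hxyz, add_comm c, add_add_self_cancel]
          rw [h, show x + w + (x + y + c) = (x + x) + (w + c + y) by abel, ZModModule.add_self,
            zero_add]
        rw [this]
        exact add_mem hw hz
      · rw [hQ, hwq, hc, hwc, add_assoc, CharTwo.add_self_eq_zero, add_zero, hq]
  intro x y hxy hx hy hq
  obtain ⟨x', hx', hfx⟩ := move x hx
  obtain ⟨y', hy', hfy⟩ := move y hy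
  refine hx'.trans ((main x' y' ?_ hfx hfy ?_).trans (hQ.reach_symm hy'))
  · have : x' + y' = (x + x') + (y + y') + (x + y) := by
      rw [show (x + x') + (y + y') + (x + y) = (x + x) + (y + y) + (x' + y') by abel,
        ZModModule.add_self, ZModModule.add_self, zero_add, zero_add]
    rw [this]
    exact add_mem (add_mem hx'.add_mem_span hy'.add_mem_span) hxy
  · rw [hQ.reach_quad hB' hx', hQ.reach_quad hB' hy', hq]

end IsE6Config

/-- For a connected `E₆`-compatible family of vectors, the quadratic form separates the nontrivial
orbits in each coset. -/
theorem quadSeparatesOrbits_of_e6Compatible {W : Type*} [Finite W] {G : SimpleGraph W}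
    (hG : E6Compatible G) (hQ : IsQuadraticRefinement ω Q) (v : W → M)
    (hadj : ∀ i j, G.Adj i j → ω (v i) (v j) = 1)
    (hnadj : ∀ i j, ¬ G.Adj i j → ω (v i) (v j) = 0) (hv : ∀ i, Q (v i) = 1) :
    ∃ e : Fin 6 → M, IsE6Config ω Q e ∧ (∀ i, e i ∈ Set.range v) ∧
      QuadSeparatesOrbits ω Q (Set.range v) := by
  classical
  obtain ⟨hconn, ⟨φ⟩⟩ := hG
  have he : IsE6Config ω Q (v ∘ φ) := by
    refine ⟨fun i j => ?_, fun i => hv _⟩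
    rw [dynkinE6_gram, Function.comp_apply, Function.comp_apply]
    split_ifs with h
    · exact hadj _ _ (φ.map_adj_iff.2 h)
    · exact hnadj _ _ fun h' => h (φ.map_adj_iff.1 h')
  refine ⟨v ∘ φ, he, fun i => ⟨φ i, rfl⟩, ?_⟩
  let P : Set (Set W) := {T | Set.range φ ⊆ T ∧ QuadSeparatesOrbits ω Q (v '' T)}
  have hP : P.Nonempty := ⟨Set.range φ, subset_rfl, by
    rw [← Set.range_comp]; exact he.quadSeparatesOrbits hQ⟩
  obtain ⟨T, ⟨hφT, hT⟩, hmax⟩ := (Set.toFinite P).exists_maximal hP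
  suffices h : T = Set.univ by rwa [h, Set.image_univ] at hT
  by_contra hne
  obtain ⟨c, hc⟩ := (Set.ne_univ_iff_exists_notMem T).1 hne
  -- A walk leaving the maximal set `T` has an edge across its boundary; its outer end can be
  -- adjoined, contradicting maximality.
  obtain ⟨p⟩ := hconn.preconnected (φ 0) c
  obtain ⟨d, -, hd1, hd2⟩ := p.exists_boundary_dart T (hφT (Set.mem_range_self 0)) hc
  suffices hins : insert d.snd T ∈ P from
    hd2 (hmax hins (Set.subset_insert _ _) (Set.mem_insert _ _))
  refine ⟨hφT.trans (Set.subset_insert _ _), ?_⟩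
  rw [Set.image_insert_eq]
  refine he.quadSeparatesOrbits_insert (B := v '' T) hQ ?_
    (fun i => ⟨φ i, hφT (Set.mem_range_self i), rfl⟩) hT ⟨d.fst, hd1, rfl⟩ (hadj _ _ d.adj) (hv _)
  rintro _ ⟨i, -, rfl⟩
  exact hv i

end Abstract

/-! ### The form, the quadratic form and the group on 𝔽₂^V -/

/-- The basis vectors of `𝔽₂^V` indexed by `B`. -/
def basisVectors {V : Type*} [DecidableEq V] (B : Set V) : Set (V → ZMod 2) :=
  (fun b : V => Pi.single b 1) '' B

theorem mk_eq_mk_iff_add_mem {V : Type*} [DecidableEq V] {B : Set V} {x y : V → ZMod 2} :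
    (Submodule.Quotient.mk x : (V → ZMod 2) ⧸ coordSubspace B) = Submodule.Quotient.mk y ↔
      x + y ∈ Submodule.span (ZMod 2) (basisVectors B) := by
  rw [Submodule.Quotient.eq, ZModModule.sub_eq_add]
  rfl

variable {V : Type*} [Fintype V]

open Classical in
/-- The number of arrows from `k` to `l`, modulo `2`. -/
noncomputable def arrowModTwo (S : Digraph V) (k l : V) : ZMod 2 := if S.Adj k l then 1 else 0

/-- A quadratic form on `𝔽₂^V` with polar form `omegaModTwo` and value `1` on the basis. -/
noncomputable def quadModTwo (S : Digraph V) (v : V → ZMod 2) : ZMod 2 :=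
  ∑ k, ∑ l, v k * arrowModTwo S k l * v l + ∑ k, (1 + arrowModTwo S k k) * v k

variable [DecidableEq V]

open Classical in
theorem omega_single_single (S : Digraph V) (k l : V) :
    omega S (Pi.single k 1) (Pi.single l 1) =
      (if S.Adj k l then 1 else 0) - if S.Adj l k then 1 else 0 := by
  have h : ∀ i j, (if S.Adj i j then (Pi.single k 1 : V → ℤ) i * (Pi.single l 1 : V → ℤ) j -
      (Pi.single k 1 : V → ℤ) j * (Pi.single l 1 : V → ℤ) i else 0) =
      (if i = k then if j = l then if S.Adj i j then (1 : ℤ) else 0 else 0 else 0) -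
      (if i = l then if j = k then if S.Adj i j then (1 : ℤ) else 0 else 0 else 0) := by
    intro i j
    simp only [Pi.single_apply]
    split_ifs <;> simp_all
  simp only [omega, LinearMap.mk₂_apply, h, Finset.sum_sub_distrib]
  simp

theorem omegaModTwo_single_single (S : Digraph V) (k l : V) :
    omegaModTwo S (Pi.single k 1) (Pi.single l 1) = arrowModTwo S k l + arrowModTwo S l k := by
  rw [omegaModTwo, Matrix.toBilin'_single, Matrix.map_apply,
    LinearMap.BilinForm.toMatrix'_apply, omega_single_single, ← CharTwo.sub_eq_add]
  simp [arrowModTwo]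

theorem omegaModTwo_apply (S : Digraph V) (v w : V → ZMod 2) :
    omegaModTwo S v w = ∑ k, ∑ l, v k * (arrowModTwo S k l + arrowModTwo S l k) * w l := by
  simp only [← omegaModTwo_single_single]
  conv_lhs => rw [omegaModTwo, Matrix.toBilin'_apply]
  simp [omegaModTwo, Matrix.toBilin'_single]

theorem isQuadraticRefinement_quadModTwo (S : Digraph V) :
    IsQuadraticRefinement (omegaModTwo S) (quadModTwo S) := by
  intro v w
  have h : ∑ k, ∑ l, v k * arrowModTwo S l k * w l = ∑ k, ∑ l, w k * arrowModTwo S k l * v l := by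
    rw [Finset.sum_comm]
    exact Finset.sum_congr rfl fun k _ => Finset.sum_congr rfl fun l _ => by ring
  simp only [quadModTwo, omegaModTwo_apply, Pi.add_apply, mul_add, add_mul,
    Finset.sum_add_distrib, h]
  ring

/-- A loop at `k` enters both the double sum and the linear term, and so cancels. -/
theorem quadModTwo_single (S : Digraph V) (k : V) : quadModTwo S (Pi.single k 1) = 1 := by
  simp [quadModTwo, Pi.single_apply, CharTwo.add_cancel_left, add_comm (1 : ZMod 2)]

theorem reductionModTwo_transvection_apply (S : Digraph V) (k : V) (v : V → ZMod 2) :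
    reductionModTwo V (transvection S k) • v =
      v + omegaModTwo S v (Pi.single k 1) • Pi.single k 1 := by
  suffices h : ((reductionModTwo V (transvection S k) : (V → ZMod 2) →ₗ[ZMod 2] (V → ZMod 2))) =
      LinearMap.id + (LinearMap.flip (omegaModTwo S) (Pi.single k 1)).smulRight
        (Pi.single k 1) by
    exact LinearMap.congr_fun h v
  refine LinearMap.pi_ext' fun j => LinearMap.ext_ring ?_
  ext i
  have h1 : (reductionModTwo V (transvection S k) : (V → ZMod 2) →ₗ[ZMod 2] (V → ZMod 2))
      (Pi.single j 1) i =
      ((((transvection S k : (V → ℤ) →ₗ[ℤ] (V → ℤ)) (Pi.single j 1)) i : ℤ) : ZMod 2) := by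
    simp [reductionModTwo, Matrix.GeneralLinearGroup.toLin]
  have h2 : ((omega S (Pi.single j 1) (Pi.single k 1) : ℤ) : ZMod 2) =
      omegaModTwo S (Pi.single j 1) (Pi.single k 1) := by
    simp [omegaModTwo, Matrix.toBilin'_single, LinearMap.BilinForm.toMatrix'_apply]
  simp only [LinearMap.comp_apply, LinearMap.single_apply, h1]
  simp only [transvection, LinearMap.sub_apply, LinearMap.add_apply, LinearMap.id_apply,
    LinearMap.smulRight_apply, LinearMap.flip_apply, Pi.sub_apply, Pi.add_apply, Pi.smul_apply,
    smul_eq_mul, Int.cast_sub, Int.cast_mul, h2, CharTwo.sub_eq_add]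
  simp [Pi.single_apply]

variable (S : Digraph V) (B : Set V)

theorem transvectionReach_of_smul {g : LinearMap.GeneralLinearGroup (ZMod 2) (V → ZMod 2)}
    (hg : g ∈ transvectionGroupModTwo S B) (x : V → ZMod 2) :
    TransvectionReach (omegaModTwo S) (basisVectors B) x (g • x) := by
  have hQ := isQuadraticRefinement_quadModTwo S
  rw [transvectionGroupModTwo, transvectionGroup, MonoidHom.map_closure] at hg
  induction hg using Subgroup.closure_induction generalizing x with
  | mem g hg =>
    obtain ⟨_, ⟨k, hk, rfl⟩, rfl⟩ := hg
    exact Relation.ReflTransGen.single (show TransvectionStep _ _ _ _ from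
      ⟨Pi.single k 1, ⟨k, hk, rfl⟩, reductionModTwo_transvection_apply S k x⟩)
  | one => rw [one_smul]; exact .refl
  | mul g h _ _ ihg ihh => rw [mul_smul]; exact (ihh x).trans (ihg _)
  | inv g _ ih => simpa using hQ.reach_symm (ih (g⁻¹ • x))

theorem exists_smul_of_transvectionReach {x y : V → ZMod 2}
    (h : TransvectionReach (omegaModTwo S) (basisVectors B) x y) :
    ∃ g ∈ transvectionGroupModTwo S B, g • x = y := by
  induction h with
  | refl => exact ⟨1, one_mem _, one_smul _ _⟩
  | tail _ h ih =>
    obtain ⟨g, hg, rfl⟩ := ih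
    obtain ⟨_, ⟨k, hk, rfl⟩, rfl⟩ := h
    refine ⟨reductionModTwo V (transvection S k) * g, mul_mem ?_ hg, ?_⟩
    · exact Subgroup.mem_map_of_mem _ (Subgroup.subset_closure ⟨k, hk, rfl⟩)
    · rw [mul_smul, reductionModTwo_transvection_apply]

theorem orbitRel_iff_transvectionReach {x y : V → ZMod 2} :
    MulAction.orbitRel (transvectionGroupModTwo S B) (V → ZMod 2) x y ↔
      TransvectionReach (omegaModTwo S) (basisVectors B) y x := by
  rw [MulAction.orbitRel_apply, MulAction.mem_orbit_iff]
  constructor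
  · rintro ⟨g, rfl⟩
    exact transvectionReach_of_smul S B g.2 y
  · intro h
    obtain ⟨g, hg, e⟩ := exists_smul_of_transvectionReach S B h
    exact ⟨⟨g, hg⟩, e⟩

theorem finrank_coordSubspace : Module.finrank (ZMod 2) (coordSubspace B) = B.ncard := by
  have hli : LinearIndependent (ZMod 2) fun b : B => (Pi.single (b : V) 1 : V → ZMod 2) := by
    have := (Pi.basisFun (ZMod 2) V).linearIndependent.comp (fun b : B => (b : V))
      Subtype.val_injective
    simpa [Function.comp_def] using this
  have := Fintype.ofFinite B
  rw [coordSubspace, Set.image_eq_range, finrank_span_eq_card hli, ← Nat.card_eq_fintype_card,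
    Nat.card_coe_set_eq]

theorem isTransvectionFixed_iff_mem_orthogonal (x : V → ZMod 2) :
    IsTransvectionFixed (omegaModTwo S) (basisVectors B) x ↔
      x ∈ (omegaModTwo S).orthogonal (coordSubspace B) := by
  have hQ := isQuadraticRefinement_quadModTwo S
  rw [LinearMap.BilinForm.mem_orthogonal_iff]
  constructor
  · intro h n hn
    rw [hQ.form_comm]
    have : coordSubspace B ≤ LinearMap.ker (omegaModTwo S x) := Submodule.span_le.2 h
    exact this hn
  · intro h b hb
    rw [hQ.form_comm]
    exact h b (Submodule.subset_span hb)

/-- For W = 𝔽₂^B, dim W + dim W^⊥ = #V + dim(W ∩ Ker), valid for degenerate forms too. -/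
theorem card_orthogonal : Nat.card ((omegaModTwo S).orthogonal (coordSubspace B)) =
    2 ^ (Bᶜ).ncard * 2 ^ Module.finrank (ZMod 2)
      ↥(coordSubspace B ⊓ LinearMap.ker (omegaModTwo S)) := by
  have h := LinearMap.BilinForm.finrank_add_finrank_orthogonal' (B := omegaModTwo S)
    (coordSubspace B)
  have hB := Set.ncard_add_ncard_compl B
  rw [finrank_coordSubspace, Module.finrank_fintype_fun_eq_card, ← Nat.card_eq_fintype_card, ← hB,
    add_assoc] at h
  rw [Module.natCard_eq_pow_finrank (K := ZMod 2), Nat.card_zmod, ← pow_add,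
    add_left_cancel h]

theorem card_quotient_coordSubspace :
    Nat.card ((V → ZMod 2) ⧸ coordSubspace B) = 2 ^ (Bᶜ).ncard := by
  have h := Submodule.finrank_quotient_add_finrank (coordSubspace B)
  have hB := Set.ncard_add_ncard_compl B
  rw [finrank_coordSubspace, Module.finrank_fintype_fun_eq_card, ← Nat.card_eq_fintype_card, ← hB,
    add_comm] at h
  rw [Module.natCard_eq_pow_finrank (K := ZMod 2), Nat.card_zmod, add_left_cancel h]

/-! ### Counting orbits by a complete invariant -/

open Classical in
/-- The complete invariant of orbits: a fixed vector itself, or the coset and the value of the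
quadratic form of a vector which is not fixed. -/
noncomputable def orbitInvariant (x : V → ZMod 2) :
    (omegaModTwo S).orthogonal (coordSubspace B) ⊕ ((V → ZMod 2) ⧸ coordSubspace B) × ZMod 2 :=
  if h : x ∈ (omegaModTwo S).orthogonal (coordSubspace B) then .inl ⟨x, h⟩
  else .inr (Submodule.Quotient.mk x, quadModTwo S x)

end SymplecticTransvections

theorem theorem3p8 {V : Type*} [Fintype V] [DecidableEq V] (S : Digraph V) (B : Set V)
    (hdir : ∀ k ∈ B, ∀ l ∈ B, k ≠ l → S.Adj k l → ¬ S.Adj l k)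
    (hB : E6Compatible (S.toSimpleGraphInclusive.induce B)) :
    Nat.card (MulAction.orbitRel.Quotient (transvectionGroupModTwo S B) (V → ZMod 2)) =
      2 ^ (Bᶜ).ncard *
        (2 + 2 ^ Module.finrank (ZMod 2)
          ↥(coordSubspace B ⊓ LinearMap.ker (omegaModTwo S))) := by
  have hQ := isQuadraticRefinement_quadModTwo S
  have hQB : ∀ b ∈ basisVectors B, quadModTwo S b = 1 := by
    rintro _ ⟨b, -, rfl⟩
    exact quadModTwo_single S b
  have hrange : Set.range (fun b : B => (Pi.single (b : V) 1 : V → ZMod 2)) = basisVectors B := by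
    rw [basisVectors, Set.image_eq_range]
  obtain ⟨e, he, heB, hsep⟩ := quadSeparatesOrbits_of_e6Compatible hB hQ
    (fun b : B => (Pi.single (b : V) 1 : V → ZMod 2)) (by
      rintro ⟨i, hi⟩ ⟨j, hj⟩ hij
      obtain ⟨hne, h | h⟩ : i ≠ j ∧ (S.Adj i j ∨ S.Adj j i) := hij
      -- Opposite arrows would cancel mod 2; `hdir` excludes them, so every edge pairs to 1.
      · simp [omegaModTwo_single_single, arrowModTwo, h, hdir i hi j hj hne h]
      · simp [omegaModTwo_single_single, arrowModTwo, h, hdir j hj i hi hne.symm h]) (by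
      rintro ⟨i, hi⟩ ⟨j, hj⟩ hij
      obtain rfl | hne := eq_or_ne i j
      · exact hQ.form_self _
      have h : ¬ (S.Adj i j ∨ S.Adj j i) := fun h => hij ⟨hne, h⟩
      rw [not_or] at h
      simp [omegaModTwo_single_single, arrowModTwo, h.1, h.2])
    (fun b => quadModTwo_single S b)
  rw [hrange] at heB hsep
  have hfix := isTransvectionFixed_iff_mem_orthogonal S B
  have hfixreach : ∀ {x y}, TransvectionReach (omegaModTwo S) (basisVectors B) x y →
      (x ∈ (omegaModTwo S).orthogonal (coordSubspace B) ∨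
        y ∈ (omegaModTwo S).orthogonal (coordSubspace B)) → x = y := by
    rintro x y h (hx | hy)
    · exact (h.eq_of_fixed ((hfix x).2 hx)).symm
    · exact (hQ.reach_symm h).eq_of_fixed ((hfix y).2 hy)
  have hinv : ∀ x y, orbitInvariant S B x = orbitInvariant S B y ↔
      MulAction.orbitRel (transvectionGroupModTwo S B) (V → ZMod 2) x y := by
    intro x y
    rw [orbitRel_iff_transvectionReach]
    constructor
    · intro h
      unfold orbitInvariant at h
      split_ifs at h with hx hy hy
      · rw [Sum.inl.injEq, Subtype.mk.injEq] at h
        rw [h]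
        exact .refl
      · rw [Sum.inr.injEq, Prod.mk.injEq, mk_eq_mk_iff_add_mem, add_comm] at h
        exact hsep y x h.1 (mt (hfix y).1 hy) (mt (hfix x).1 hx) h.2.symm
    · intro h
      by_cases hx : x ∈ (omegaModTwo S).orthogonal (coordSubspace B)
      · rw [hfixreach h (.inr hx)]
      by_cases hy : y ∈ (omegaModTwo S).orthogonal (coordSubspace B)
      · rw [hfixreach h (.inl hy)]
      rw [orbitInvariant, orbitInvariant, dif_neg hx, dif_neg hy, hQ.reach_quad hQB h,
        mk_eq_mk_iff_add_mem.2 (add_comm y x ▸ h.add_mem_span)]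
  have hsurj : Function.Surjective (orbitInvariant S B) := by
    rintro (⟨x, hx⟩ | ⟨c, q⟩)
    · exact ⟨x, dif_pos hx⟩
    · obtain ⟨x, rfl⟩ := Submodule.Quotient.mk_surjective _ c
      -- The E₆ component makes both values of Q occur on non-fixed vectors of every coset.
      obtain ⟨y, hxy, hy, rfl⟩ := he.exists_not_fixed hQ heB x q
      exact ⟨y, by
        rw [orbitInvariant, dif_neg (mt (hfix y).2 hy),
          mk_eq_mk_iff_add_mem.2 (add_comm x y ▸ hxy)]⟩
  let F : MulAction.orbitRel.Quotient (transvectionGroupModTwo S B) (V → ZMod 2) →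
      (omegaModTwo S).orthogonal (coordSubspace B) ⊕ ((V → ZMod 2) ⧸ coordSubspace B) × ZMod 2 :=
    Quotient.lift (orbitInvariant S B) fun x y h => (hinv x y).2 h
  have hF : Function.Bijective F := by
    constructor
    · rintro ⟨x⟩ ⟨y⟩ h
      exact Quotient.sound ((hinv x y).1 h)
    · intro z
      obtain ⟨x, rfl⟩ := hsurj z
      exact ⟨Quotient.mk _ x, rfl⟩
  have : Finite ((V → ZMod 2) ⧸ coordSubspace B) :=
    Finite.of_surjective _ (Submodule.Quotient.mk_surjective _)
  rw [Nat.card_congr (Equiv.ofBijective F hF), Nat.card_sum, Nat.card_prod, card_orthogonal,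
    card_quotient_coordSubspace, Nat.card_zmod]
  ring
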